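/- Let $Y$ be a positive random variable whose moment generating function $\mathbb E(e^{Yu})$ is finite for $u$ in a neighbourhood of $0$. Let $\lambda>0$, $\theta>0$ and $c=(1+\theta)\lambda\,\mathbb E Y$. For real $n>0$ and $x\ge 0$ consider the scaled Cramér–Lundberg surplus process $$X^{(n)}_t = x + c_n t-\sum_{i=1}^{N^{(n)}_t} Y^{(n)}_i,\qquad t\ge 0,$$ where $c_n=c+(\sqrt n-1)\lambda\,\mathbb E Y$, $N^{(n)}$ is a homogeneous Poisson process with intensity $n\lambda$, and $Y^{(n)}_1,Y^{(n)}_2,\dots$ are i.i.d. with the law of $Y/\sqrt n$ and independent of $N^{(n)}$. Let $\tau_n=\inf\{t\ge 0: X^{(n)}_t<0\}$ (with $\inf\emptyset=\infty$) be the time of ruin and $\psi_n(x)=\mathbb P(\tau_n<\infty\mid X^{(n)}_0=x)$ the probability of ultimate ruin. Put $$\gamma=\frac{2\theta\,\mathbb E Y}{\mathbb E(Y^2)}.$$ If $$\alpha>\frac{\gamma^2}{3}\,\frac{\mathbb E(Y^3)}{\mathbb E(Y^2)},$$ then there exists $N>0$ such that, for all $n>N$ and all $x\ge 0$, $$\psi_n(x)<\exp\!\left(-\Big(\gamma-\frac{\alpha}{\sqrt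 n}\Big)x\right).$$ -/

import Mathlib

open MeasureTheory ProbabilityTheory
open scoped NNReal ENNReal

namespace CramerLundberg

noncomputable section

variable {Ω : Type*} [MeasurableSpace Ω]

/-- The arrival time `W₀ + ⋯ + W_{k-1}` of the `k`-th claim (`k ≥ 1`), where the `W i` are the
waiting times between successive claims. -/
def arrivalTime (W : ℕ → Ω → ℝ) (k : ℕ) (ω : Ω) : ℝ :=
  ∑ i ∈ Finset.range k, W i ω

/-- The counting process `N_t = #{k ≥ 1 : k-th claim arrives by time t}`. For i.i.d. exponential
waiting times of rate `lam` this is the homogeneous Poisson process of intensity `lam`; the set is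
then almost surely finite for all `t` simultaneously. -/
def claimCount (W : ℕ → Ω → ℝ) (t : ℝ≥0) (ω : Ω) : ℕ :=
  {k : ℕ | 1 ≤ k ∧ arrivalTime W k ω ≤ t}.ncard

/-- The surplus `X_t = x + c t - ∑_{i=1}^{N_t} Y_i`; the claims are numbered from `0`. -/
def surplus (c : ℝ) (W Y : ℕ → Ω → ℝ) (x : ℝ) (t : ℝ≥0) (ω : Ω) : ℝ :=
  x + c * t - ∑ i ∈ Finset.range (claimCount W t ω), Y i ω

/-- The time of ruin `τ = inf {t ≥ 0 : X_t < 0}`, with `inf ∅ = ∞`. -/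
def ruinTime (c : ℝ) (W Y : ℕ → Ω → ℝ) (x : ℝ) (ω : Ω) : ℝ≥0∞ :=
  sInf ((fun t : ℝ≥0 => (t : ℝ≥0∞)) '' {t : ℝ≥0 | surplus c W Y x t ω < 0})

/-- The probability of ultimate ruin `ψ(x) = P(τ < ∞ | X_0 = x)`. -/
def ruinProb (P : Measure Ω) (c : ℝ) (W Y : ℕ → Ω → ℝ) (x : ℝ) : ℝ :=
  P.real {ω | ruinTime c W Y x ω < ⊤}

/-- The probabilistic data of the Cramér–Lundberg model: claims arrive according to a homogeneous
Poisson process of intensity `lam` (i.i.d. exponential waiting times `W i` of rate `lam`), the claim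
sizes `Y i` are i.i.d. with law `ν`, and the claim sizes are independent of the arrivals. -/
structure IsRiskModel (lam : ℝ) (ν : Measure ℝ) (P : Measure Ω) (W Y : ℕ → Ω → ℝ) : Prop where
  measurable_wait : ∀ i, Measurable (W i)
  measurable_claim : ∀ i, Measurable (Y i)
  law_wait : ∀ i, HasLaw (W i) (expMeasure lam) P
  law_claim : ∀ i, HasLaw (Y i) ν P
  indep_wait : iIndepFun W P
  indep_claim : iIndepFun Y P
  indep_wait_claim : IndepFun (fun ω i => W i ω) (fun ω i => Y i ω) P

/-- The scaled intensity `λ_n = n λ`. -/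
def scaledIntensity (lam n : ℝ) : ℝ := n * lam

/-- The law of the scaled claim `Y_n = Y / √n`, where `Y` has law `μ`. -/
def scaledClaimLaw (μ : Measure ℝ) (n : ℝ) : Measure ℝ := μ.map (fun y => y / √n)

/-- The scaled premium rate `c_n = c + (√n - 1) λ E[Y]`, where `Y` has law `μ`. -/
def scaledPremium (c lam : ℝ) (μ : Measure ℝ) (n : ℝ) : ℝ :=
  c + (√n - 1) * lam * ∫ y, y ∂μ

/-- The exponent `γ = 2 θ E[Y] / E[Y²]`, where `Y` has law `μ`. -/
def diffusionExponent (θ : ℝ) (μ : Measure ℝ) : ℝ :=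
  2 * θ * (∫ y, y ∂μ) / ∫ y, y ^ 2 ∂μ

end

end CramerLundberg

open CramerLundberg

/-! Put `s = 1 / √n` and `r = γ - α * s`. Ruin occurs only at claims, so it forces the walk with
steps `Y i - c * W i` above `x`. The products of `exp (r * (Y i - c * W i)) / φ`, with `φ` the mean
of the exponential, form a positive martingale, and Doob's maximal inequality bounds the ruin
probability by `φ * exp (-r * x)` when `φ ≤ 1` (`measure_exists_lt_sum_le`). If `φ < 1` the bound is
strictly below `exp (-r * x)` for every `x ≥ 0` at once (`ruinProb_lt_exp`).

It remains to see `φ < 1` for small `s`. Expanding the moment generating function at `r * s`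
(`integral_exp_mul_le_cubic`), the order `s` terms cancel by the choice of premium and the order `s
^ 2` terms by the choice of `γ`. At order `s ^ 3` the sign is that of `α * m₂ / 2 - γ ^ 2 * m₃ / 6`,
positive exactly under the assumption on `α` (`exists_forall_lt_cubic`). -/

namespace CramerLundberg

/-! ### Independent pairs, product martingales and the maximal inequality -/

section Independence

variable {Ω : Type*} [MeasurableSpace Ω] {P : Measure Ω}

/-- Two independent sequences of independent variables form a sequence of independent pairs. -/
theorem iIndepFun_prodMk {ι α β : Type*} [MeasurableSpace α] [MeasurableSpace β]
    {W : ι → Ω → α} {Y : ι → Ω → β} (hW : ∀ i, Measurable (W i)) (hY : ∀ i, Measurable (Y i))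
    (iW : iIndepFun W P) (iY : iIndepFun Y P)
    (h : IndepFun (fun ω i => W i ω) (fun ω i => Y i ω) P) :
    iIndepFun (fun i ω => (W i ω, Y i ω)) P := by
  let π : ι → Set (Set Ω) := fun i =>
    (fun s : Set (α × β) => (fun ω => (W i ω, Y i ω)) ⁻¹' s) ''
      Set.image2 (· ×ˢ ·) {s : Set α | MeasurableSet s} {t : Set β | MeasurableSet t}
  refine iIndepSets.iIndep (fun i => ((hW i).prodMk (hY i)).comap_le) π ?_ ?_ ?_
  · intro i
    exact isPiSystem_prod.comap _
  · intro i
    rw [← generateFrom_prod, MeasurableSpace.comap_generateFrom]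
  · rw [iIndepSets_iff]
    intro s f hf
    have key : ∀ i, ∃ A : Set α, ∃ B : Set β, MeasurableSet A ∧ MeasurableSet B ∧
        (i ∈ s → f i = W i ⁻¹' A ∩ Y i ⁻¹' B) := by
      intro i
      by_cases hi : i ∈ s
      · obtain ⟨_, ⟨A, hA, B, hB, rfl⟩, h⟩ := hf i hi
        exact ⟨A, B, hA, hB, fun _ => h.symm⟩
      · exact ⟨∅, ∅, .empty, .empty, fun h => absurd h hi⟩
    choose A B hA hB hAB using key
    have pair : ∀ t : Finset ι, P ((⋂ i ∈ t, W i ⁻¹' A i) ∩ ⋂ i ∈ t, Y i ⁻¹' B i)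
        = P (⋂ i ∈ t, W i ⁻¹' A i) * P (⋂ i ∈ t, Y i ⁻¹' B i) := by
      intro t
      have := h.measure_inter_preimage_eq_mul (⋂ i ∈ t, (fun w : ι → α => w i) ⁻¹' A i)
        (⋂ i ∈ t, (fun w : ι → β => w i) ⁻¹' B i)
        (t.measurableSet_biInter fun i _ => measurable_pi_apply i (hA i))
        (t.measurableSet_biInter fun i _ => measurable_pi_apply i (hB i))
      simpa only [Set.preimage_iInter, Set.preimage_preimage] using this
    have e : ⋂ i ∈ s, f i = (⋂ i ∈ s, W i ⁻¹' A i) ∩ ⋂ i ∈ s, Y i ⁻¹' B i := by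
      simp only [← Set.iInter_inter_distrib]
      exact Set.iInter₂_congr fun i hi => hAB i hi
    rw [e, pair, iW.measure_inter_preimage_eq_mul s (fun i _ => hA i),
      iY.measure_inter_preimage_eq_mul s (fun i _ => hB i), ← Finset.prod_mul_distrib]
    refine Finset.prod_congr rfl fun i hi => ?_
    rw [hAB i hi]
    -- The singleton case of `pair` factorises each single rectangle.
    simpa using (pair {i}).symm

variable {Z : ℕ → Ω → ℝ}

theorem iIndepFun.integrable_prod_range [IsProbabilityMeasure P] (hm : ∀ i, Measurable (Z i))
    (hi : iIndepFun Z P) (hint : ∀ i, Integrable (Z i) P) (k : ℕ) :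
    Integrable (∏ i ∈ Finset.range k, Z i) P := by
  induction k with
  | zero =>
    rw [Finset.prod_range_zero]
    exact integrable_const (1 : ℝ)
  | succ k ih =>
    rw [Finset.prod_range_succ]
    exact (hi.indepFun_prod_range_succ hm k).integrable_mul ih (hint k)

/-- Partial products of independent variables of mean `1` form a martingale. -/
theorem martingale_prod_range [IsProbabilityMeasure P] (hm : ∀ i, StronglyMeasurable (Z i))
    (hi : iIndepFun Z P) (hint : ∀ i, Integrable (Z i) P) (h1 : ∀ i, ∫ ω, Z i ω ∂P = 1) :
    Martingale (fun k => ∏ i ∈ Finset.range (k + 1), Z i) (Filtration.natural Z hm) P := by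
  have hint' := iIndepFun.integrable_prod_range (fun i => (hm i).measurable) hi hint
  have adp : StronglyAdapted (Filtration.natural Z hm)
      (fun k => ∏ i ∈ Finset.range (k + 1), Z i) := by
    intro k
    refine Finset.stronglyMeasurable_prod _ fun i hik => ?_
    exact (Filtration.stronglyAdapted_natural hm i).mono
      ((Filtration.natural Z hm).mono (Nat.lt_succ_iff.1 (Finset.mem_range.1 hik)))
  refine martingale_nat adp (fun k => hint' _) fun k => ?_
  rw [Finset.prod_range_succ _ (k + 1)]
  have a := condExp_mul_of_stronglyMeasurable_left (adp k)
    (g := Z (k + 1)) (by rw [← Finset.prod_range_succ]; exact hint' _) (hint (k + 1))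
  have b := iIndepFun.condExp_natural_ae_eq_of_lt hm hi (Nat.lt_succ_self k)
  filter_upwards [a, b] with ω ha hb
  rw [ha, Pi.mul_apply, hb, h1, mul_one]

/-- A maximal inequality for the running maximum of a random walk with negative exponential
drift: the first step already gains the factor `φ = E exp (r X)`. -/
theorem measure_exists_lt_sum_le [IsProbabilityMeasure P] {X : ℕ → Ω → ℝ} {r φ : ℝ}
    (hr : 0 ≤ r) (hφ : 0 < φ) (hφ1 : φ ≤ 1) (hm : ∀ i, Measurable (X i)) (hi : iIndepFun X P)
    (hint : ∀ i, Integrable (fun ω => Real.exp (r * X i ω)) P)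
    (hX : ∀ i, ∫ ω, Real.exp (r * X i ω) ∂P = φ) (x : ℝ) :
    P {ω | ∃ k, x < ∑ i ∈ Finset.range (k + 1), X i ω}
      ≤ ENNReal.ofReal (φ * Real.exp (-r * x)) := by
  let Z : ℕ → Ω → ℝ := fun i ω => Real.exp (r * X i ω) / φ
  have hZm : ∀ i, Measurable (Z i) := fun i => by fun_prop
  have hZi : iIndepFun Z P :=
    hi.comp (fun _ y => Real.exp (r * y) / φ) fun _ => by fun_prop
  have hZint : ∀ i, Integrable (Z i) P := fun i => (hint i).div_const φ
  have hZ1 : ∀ i, ∫ ω, Z i ω ∂P = 1 := fun i => by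
    simp only [Z, integral_div, hX]
    exact div_self hφ.ne'
  have mart := martingale_prod_range (fun i => (hZm i).stronglyMeasurable) hZi hZint hZ1
  have nonneg : ∀ k, (0 : Ω → ℝ) ≤ ∏ i ∈ Finset.range (k + 1), Z i := fun k ω => by
    rw [Finset.prod_apply]
    exact Finset.prod_nonneg fun i _ => by positivity
  have mean : ∀ k, ∫ ω, (∏ i ∈ Finset.range (k + 1), Z i) ω ∂P = 1 := fun k => by
    have := mart.setIntegral_eq (Nat.zero_le k) (MeasurableSet.univ)
    simpa [hZ1] using this.symm
  set ε : ℝ≥0 := ⟨Real.exp (r * x) / φ, by positivity⟩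
  have mem : ∀ ω k, x < ∑ i ∈ Finset.range (k + 1), X i ω →
      (ε : ℝ) ≤ (∏ i ∈ Finset.range (k + 1), Z i) ω := by
    intro ω k hk
    have e : (∏ i ∈ Finset.range (k + 1), Z i) ω
        = Real.exp (r * ∑ i ∈ Finset.range (k + 1), X i ω) / φ ^ (k + 1) := by
      rw [Finset.prod_apply, Finset.mul_sum, Real.exp_sum, Finset.prod_div_distrib,
        Finset.prod_const, Finset.card_range]
    rw [e]
    change Real.exp (r * x) / φ ≤ _
    -- At least one step has been taken, so one factor `φ` always survives; it later gives
    -- strictness, even at `x = 0`.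
    have : φ ^ (k + 1) ≤ φ := pow_le_of_le_one hφ.le hφ1 k.succ_ne_zero
    have := mul_le_mul_of_nonneg_left hk.le hr
    gcongr
  have fin : ∀ n, P {ω | ∃ k ≤ n, x < ∑ i ∈ Finset.range (k + 1), X i ω}
      ≤ ENNReal.ofReal (φ * Real.exp (-r * x)) := by
    intro n
    have ineq := maximal_ineq mart.submartingale nonneg (ε := ε) n
    set E := {ω | (ε : ℝ) ≤ (Finset.range (n + 1)).sup' Finset.nonempty_range_add_one
      fun k => (∏ i ∈ Finset.range (k + 1), Z i) ω}
    have sub : {ω | ∃ k ≤ n, x < ∑ i ∈ Finset.range (k + 1), X i ω} ⊆ E := by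
      rintro ω ⟨k, hk, hx⟩
      exact (mem ω k hx).trans
        (Finset.le_sup' (fun k => (∏ i ∈ Finset.range (k + 1), Z i) ω)
          (Finset.mem_range.2 (Nat.lt_succ_of_le hk)))
    have le1 : ε * P E ≤ 1 := by
      refine ineq.trans ?_
      rw [← ENNReal.ofReal_one, ← mean n]
      exact ENNReal.ofReal_le_ofReal
        (setIntegral_le_integral (mart.integrable n) (.of_forall (nonneg n)))
    have e : ENNReal.ofReal (φ * Real.exp (-r * x)) = (ε : ℝ≥0∞)⁻¹ := by
      rw [← ENNReal.ofReal_coe_nnreal, ← ENNReal.ofReal_inv_of_pos (show 0 < (ε : ℝ) from div_pos (Real.exp_pos _) hφ)]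
      congr 1
      change _ = (Real.exp (r * x) / φ)⁻¹
      rw [inv_div, neg_mul, Real.exp_neg, div_eq_mul_inv]
    rw [e]
    refine (measure_mono sub).trans ?_
    rw [ENNReal.le_inv_iff_mul_le, mul_comm]
    exact le1
  have un : {ω | ∃ k, x < ∑ i ∈ Finset.range (k + 1), X i ω}
      = ⋃ n, {ω | ∃ k ≤ n, x < ∑ i ∈ Finset.range (k + 1), X i ω} := by
    ext ω
    simp only [Set.mem_ofPred_eq, Set.mem_iUnion]
    exact ⟨fun ⟨k, hk⟩ => ⟨k, k, le_rfl, hk⟩, fun ⟨_, k, _, hk⟩ => ⟨k, hk⟩⟩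
  have mono : Monotone fun n => {ω | ∃ k ≤ n, x < ∑ i ∈ Finset.range (k + 1), X i ω} :=
    fun n m hnm ω ⟨k, hk, h⟩ => ⟨k, hk.trans hnm, h⟩
  rw [un, mono.measure_iUnion]
  exact iSup_le fin

end Independence

/-! ### Laplace transform of the exponential law -/

section Exponential

theorem expMeasure_eq_withDensity (lam : ℝ) :
    expMeasure lam = volume.withDensity (exponentialPDF lam) := rfl

theorem measurable_exponentialPDF (lam : ℝ) : Measurable (exponentialPDF lam) :=
  (measurable_exponentialPDFReal lam).ennreal_ofReal

theorem ae_nonneg_expMeasure (lam : ℝ) : ∀ᵐ w ∂expMeasure lam, 0 ≤ w := by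
  rw [expMeasure_eq_withDensity, ae_withDensity_iff (measurable_exponentialPDF lam)]
  refine .of_forall fun w hw => ?_
  by_contra h
  exact hw (exponentialPDF_of_neg (not_le.1 h))

theorem integrable_exp_neg_mul_expMeasure {lam a : ℝ} (hlam : 0 < lam) (ha : 0 ≤ a) :
    Integrable (fun w => Real.exp (-a * w)) (expMeasure lam) := by
  have := isProbabilityMeasure_expMeasure hlam
  refine (integrable_const (1 : ℝ)).mono' (by fun_prop) ?_
  filter_upwards [ae_nonneg_expMeasure lam] with w hw
  rw [Real.norm_eq_abs, Real.abs_exp, Real.exp_le_one_iff]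
  nlinarith

theorem integral_exp_neg_mul_expMeasure {lam a : ℝ} (hlam : 0 < lam) (ha : 0 ≤ a) :
    ∫ w, Real.exp (-a * w) ∂expMeasure lam = lam / (lam + a) := by
  have e : ∀ w : ℝ, (exponentialPDF lam w).toReal • Real.exp (-a * w)
      = (Set.Ici (0 : ℝ)).indicator (fun w => lam * Real.exp (-(lam + a) * w)) w := by
    intro w
    by_cases hw : 0 ≤ w
    · rw [exponentialPDF_of_nonneg hw, ENNReal.toReal_ofReal (by positivity),
        Set.indicator_of_mem (Set.mem_Ici.2 hw), smul_eq_mul, mul_assoc, ← Real.exp_add]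
      congr 2
      ring
    · rw [exponentialPDF_of_neg (not_le.1 hw), Set.indicator_of_notMem (by simpa using hw)]
      simp
  rw [expMeasure_eq_withDensity, integral_withDensity_eq_integral_toReal_smul
    (measurable_exponentialPDF lam) (.of_forall fun _ => ENNReal.ofReal_lt_top)]
  simp_rw [e]
  rw [integral_indicator measurableSet_Ici, integral_Ici_eq_integral_Ioi, integral_const_mul,
    integral_exp_mul_Ioi (by linarith)]
  have : lam + a ≠ 0 := by positivity
  rw [mul_zero, Real.exp_zero]
  field_simp

end Exponential

/-! ### Strict Lundberg inequality -/

section Ruin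

/-- Ruin can only happen at a claim. -/
theorem exists_lt_sum_of_surplus_neg {Ω : Type*} {W Y : ℕ → Ω → ℝ} {c x : ℝ} (hc : 0 ≤ c) (hx : 0 ≤ x) {ω : Ω}
    (hW : ∀ i, 0 ≤ W i ω) {t : ℝ≥0} (ht : surplus c W Y x t ω < 0) :
    ∃ k, x < ∑ i ∈ Finset.range (k + 1), (Y i ω - c * W i ω) := by
  have hct : 0 ≤ c * (t : ℝ) := mul_nonneg hc t.2
  have mono : Monotone fun k => arrivalTime W k ω :=
    monotone_nat_of_le_succ fun k => by
      simp only [arrivalTime, Finset.sum_range_succ]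
      linarith [hW k]
  unfold surplus at ht
  -- An infinite set of arrivals has `ncard` equal to `0` and falls in the first case, so finiteness
  -- of the count is never needed.
  rcases hk : claimCount W t ω with _ | k
  · rw [hk] at ht
    simp at ht
    linarith
  · rw [hk] at ht
    have arr : arrivalTime W (k + 1) ω ≤ t := by
      by_contra hlt
      have sub : {j : ℕ | 1 ≤ j ∧ arrivalTime W j ω ≤ t} ⊆ ↑(Finset.Icc 1 k) := by
        rintro j ⟨h1, h2⟩
        rw [Finset.coe_Icc]
        refine ⟨h1, ?_⟩
        by_contra hj
        exact hlt ((mono (not_le.1 hj)).trans h2)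
      have := Set.ncard_le_ncard sub (Finset.finite_toSet _)
      rw [Set.ncard_coe_finset, Nat.card_Icc] at this
      unfold claimCount at hk
      omega
    refine ⟨k, ?_⟩
    rw [Finset.sum_sub_distrib, ← Finset.mul_sum]
    have := mul_le_mul_of_nonneg_left arr hc
    unfold arrivalTime at this
    linarith

/-- A strict form of Lundberg's inequality. -/
theorem ruinProb_lt_exp {Ω : Type*} [MeasurableSpace Ω] {P : Measure Ω} [IsProbabilityMeasure P]
    {W Y : ℕ → Ω → ℝ} {lam c r : ℝ} {ν : Measure ℝ} (h : IsRiskModel lam ν P W Y) (hlam : 0 < lam) (hc : 0 ≤ c) (hr : 0 ≤ r)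
    (hint : Integrable (fun y => Real.exp (r * y)) ν)
    (hlt : lam * (∫ y, Real.exp (r * y) ∂ν - 1) < c * r) {x : ℝ} (hx : 0 ≤ x) :
    ruinProb P c W Y x < Real.exp (-r * x) := by
  have hν : IsProbabilityMeasure ν := (h.law_claim 0).isProbabilityMeasure_iff.1 inferInstance
  have hcr : 0 ≤ c * r := mul_nonneg hc hr
  have hφ : 0 < ∫ y, Real.exp (r * y) ∂ν := integral_exp_pos hint
  -- This is the mean of `exp (r * (Y i - c * W i))`; clearing the denominator turns `hlt` into `φ <
  -- 1`.
  set φ := (lam / (lam + c * r)) * ∫ y, Real.exp (r * y) ∂ν with hφdef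
  have hφ0 : 0 < φ := by positivity
  have hφ1 : φ < 1 := by
    rw [hφdef, div_mul_eq_mul_div, div_lt_one (by positivity)]
    linarith
  have hXm : ∀ i, Measurable fun ω => Y i ω - c * W i ω := fun i =>
    (h.measurable_claim i).sub ((h.measurable_wait i).const_mul c)
  have pairs := iIndepFun_prodMk h.measurable_wait h.measurable_claim h.indep_wait h.indep_claim
    h.indep_wait_claim
  have hXi : iIndepFun (fun i ω => Y i ω - c * W i ω) P :=
    pairs.comp (fun _ p => p.2 - c * p.1) fun _ => by fun_prop
  have split : ∀ i ω, Real.exp (r * (Y i ω - c * W i ω))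
      = Real.exp (-(c * r) * W i ω) * Real.exp (r * Y i ω) := fun i ω => by
    rw [← Real.exp_add]
    congr 1
    ring
  have ind : ∀ i, IndepFun (fun ω => Real.exp (-(c * r) * W i ω))
      (fun ω => Real.exp (r * Y i ω)) P := fun i =>
    h.indep_wait_claim.comp (φ := fun w : ℕ → ℝ => Real.exp (-(c * r) * w i))
      (ψ := fun y : ℕ → ℝ => Real.exp (r * y i)) (by fun_prop) (by fun_prop)
  have intW : ∀ i, Integrable (fun ω => Real.exp (-(c * r) * W i ω)) P := fun i => by
    have := integrable_exp_neg_mul_expMeasure hlam hcr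
    rw [← (h.law_wait i).map_eq] at this
    exact this.comp_measurable (h.measurable_wait i)
  have intY : ∀ i, Integrable (fun ω => Real.exp (r * Y i ω)) P := fun i => by
    have := hint
    rw [← (h.law_claim i).map_eq] at this
    exact this.comp_measurable (h.measurable_claim i)
  have bound := measure_exists_lt_sum_le hr hφ0 hφ1.le hXm hXi
    (fun i => by
      simp only [split]
      exact (ind i).integrable_mul (intW i) (intY i))
    (fun i => by
      simp only [split]
      rw [(ind i).integral_fun_mul_eq_mul_integral (intW i).1 (intY i).1, hφdef,
        ← integral_exp_neg_mul_expMeasure hlam hcr]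
      congr 1
      · exact (h.law_wait i).integral_comp (f := fun w => Real.exp (-(c * r) * w)) (by fun_prop)
      · exact (h.law_claim i).integral_comp (f := fun y => Real.exp (r * y)) (by fun_prop)) x
  have nonneg : ∀ᵐ ω ∂P, ∀ i, 0 ≤ W i ω := by
    rw [ae_all_iff]
    intro i
    have := ae_nonneg_expMeasure lam
    rw [← (h.law_wait i).map_eq] at this
    exact ae_of_ae_map (h.measurable_wait i).aemeasurable this
  have le : P {ω | ruinTime c W Y x ω < ⊤}
      ≤ P {ω | ∃ k, x < ∑ i ∈ Finset.range (k + 1), (Y i ω - c * W i ω)} := by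
    refine measure_mono_ae ?_
    filter_upwards [nonneg] with ω hω hruin
    obtain ⟨_, ⟨t, ht, rfl⟩, -⟩ := sInf_lt_iff.1 (show ruinTime c W Y x ω < ⊤ from hruin)
    exact exists_lt_sum_of_surplus_neg hc hx hω ht
  calc ruinProb P c W Y x ≤ φ * Real.exp (-r * x) :=
        ENNReal.toReal_le_of_le_ofReal (by positivity) (le.trans bound)
    _ < Real.exp (-r * x) := mul_lt_of_lt_one_left (Real.exp_pos _) hφ1

end Ruin

end CramerLundberg

open CramerLundberg


/-! ### Third-order expansion and the adjustment inequality -/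

theorem Real.exp_le_cubic_add {x : ℝ} (hx : 0 ≤ x) :
    Real.exp x ≤ 1 + x + x ^ 2 / 2 + x ^ 3 / 6 + x ^ 4 * Real.exp x := by
  have h := Complex.norm_exp_sub_sum_le_norm_mul_exp (x : ℂ) 4
  have e : Complex.exp x - ∑ m ∈ Finset.range 4, (x : ℂ) ^ m / (m.factorial : ℂ)
      = ((Real.exp x - (1 + x + x ^ 2 / 2 + x ^ 3 / 6) : ℝ) : ℂ) := by
    simp [Finset.sum_range_succ, Nat.factorial]
  rw [e, Complex.norm_real, Complex.norm_real, Real.norm_eq_abs, Real.norm_eq_abs,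
    abs_of_nonneg hx] at h
  linarith [le_abs_self (Real.exp x - (1 + x + x ^ 2 / 2 + x ^ 3 / 6))]

theorem interior_integrableExpSet_of_Ioo {μ : Measure ℝ} {u : ℝ}
    (h : ∀ s ∈ Set.Ioo (-u) u, Integrable (fun y : ℝ => Real.exp (y * s)) μ) :
    Set.Ioo (-u) u ⊆ interior (integrableExpSet id μ) :=
  interior_maximal (fun s hs => by simpa [integrableExpSet, mul_comm] using h s hs) isOpen_Ioo

/-- The cubic coefficient must be exact, since it fixes the threshold for `α`; the quartic one only
has to be uniform in `t`. Stopping at `u / 2` lets a single exponentially weighted fourth moment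
serve as `K`. -/
theorem integral_exp_mul_le_cubic {μ : Measure ℝ} [IsProbabilityMeasure μ]
    (hpos : ∀ᵐ y ∂μ, 0 < y) {u : ℝ} (hu : 0 < u)
    (h : ∀ s ∈ Set.Ioo (-u) u, Integrable (fun y : ℝ => Real.exp (y * s)) μ) :
    ∃ K : ℝ, 0 ≤ K ∧ ∀ t, 0 ≤ t → t ≤ u / 2 → ∫ y, Real.exp (t * y) ∂μ
      ≤ 1 + t * (∫ y, y ∂μ) + t ^ 2 * (∫ y, y ^ 2 ∂μ) / 2 + t ^ 3 * (∫ y, y ^ 3 ∂μ) / 6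
        + K * t ^ 4 := by
  have sub := interior_integrableExpSet_of_Ioo h
  have mom : ∀ n : ℕ, Integrable (fun y : ℝ => y ^ n) μ := fun n => by
    simpa using integrable_pow_mul_exp_of_mem_interior_integrableExpSet
      (sub ⟨by linarith, hu⟩ : (0 : ℝ) ∈ _) n
  have rem : Integrable (fun y : ℝ => y ^ 4 * Real.exp (u / 2 * y)) μ :=
    integrable_pow_mul_exp_of_mem_interior_integrableExpSet
      (X := id) (sub ⟨by linarith, by linarith⟩ : u / 2 ∈ _) 4
  refine ⟨∫ y, y ^ 4 * Real.exp (u / 2 * y) ∂μ, ?_, fun t ht0 htu => ?_⟩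
  · exact integral_nonneg fun y => by positivity
  have m1 : Integrable (fun y : ℝ => t * y) μ := by simpa using (mom 1).const_mul t
  have m2 := ((mom 2).const_mul (t ^ 2)).div_const 2
  have m3 := ((mom 3).const_mul (t ^ 3)).div_const 6
  have m4 := rem.mul_const (t ^ 4)
  have m01 : Integrable (fun y : ℝ => 1 + t * y) μ := (integrable_const (1 : ℝ)).add m1
  have m02 : Integrable (fun y : ℝ => 1 + t * y + t ^ 2 * y ^ 2 / 2) μ := m01.add m2
  have m03 : Integrable (fun y : ℝ => 1 + t * y + t ^ 2 * y ^ 2 / 2 + t ^ 3 * y ^ 3 / 6) μ :=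
    m02.add m3
  calc ∫ y, Real.exp (t * y) ∂μ
      ≤ ∫ y, (1 + t * y + t ^ 2 * y ^ 2 / 2 + t ^ 3 * y ^ 3 / 6
          + y ^ 4 * Real.exp (u / 2 * y) * t ^ 4) ∂μ := by
        refine integral_mono_of_nonneg (.of_forall fun y => (Real.exp_pos _).le)
          (m03.add m4) ?_
        filter_upwards [hpos] with y hy
        have a := Real.exp_le_cubic_add (mul_nonneg ht0 hy.le)
        have b : (t * y) ^ 4 * Real.exp (t * y)
            ≤ (t * y) ^ 4 * Real.exp (u / 2 * y) := by gcongr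
        simp only [mul_pow] at a b
        linarith
    _ = _ := by
        rw [integral_add m03 m4, integral_add m02 m3, integral_add m01 m2,
          integral_add (integrable_const 1) m1]
        simp only [integral_div, integral_const_mul, integral_mul_const]
        rw [integral_const_mul]
        simp

/-- The adjustment inequality for the scaled model, in the variable `s = 1 / √n`. -/
theorem exists_forall_lt_cubic {m₁ m₂ m₃ θ γ α K u : ℝ} (hm₂ : 0 < m₂)
    (hγ : 0 < γ) (hγm : γ * m₂ = 2 * θ * m₁) (hK : 0 ≤ K) (hu : 0 < u)
    (hα : γ ^ 2 / 3 * (m₃ / m₂) < α) (hα0 : 0 ≤ α) (hm₃ : 0 ≤ m₃) :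
    ∃ δ > 0, ∀ s, 0 < s → s < δ → 0 < γ - α * s ∧ (γ - α * s) * s ≤ u ∧
      ((γ - α * s) * s * m₁ + ((γ - α * s) * s) ^ 2 * m₂ / 2 + ((γ - α * s) * s) ^ 3 * m₃ / 6
        + K * ((γ - α * s) * s) ^ 4) < s * (1 + θ * s) * m₁ * (γ - α * s) := by
  have hgap : 0 < α * m₂ / 2 - γ ^ 2 * m₃ / 6 := by
    rw [← mul_div_assoc, div_lt_iff₀ hm₂] at hα
    linarith
  set g := α * m₂ / 2 - γ ^ 2 * m₃ / 6 with hg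
  -- The three bounds keep `r` positive, keep `r * s` at most `u`, and keep the quartic remainder
  -- below the gap `g`. Each `+ 1` guards against a zero denominator.
  refine ⟨min (γ / (α + 1)) (min (u / γ) (g / (K * γ ^ 3 + 1))), by positivity,
    fun s hs hsδ => ?_⟩
  obtain ⟨h1, h2⟩ := lt_min_iff.1 hsδ
  obtain ⟨h2, h3⟩ := lt_min_iff.1 h2
  rw [lt_div_iff₀ (by positivity)] at h1 h2 h3
  set r := γ - α * s with hr
  have hr0 : 0 < r := by rw [hr]; linarith
  have hrγ : r ≤ γ := by rw [hr]; nlinarith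
  refine ⟨hr0, by nlinarith, ?_⟩
  have r2 : r ^ 2 ≤ γ ^ 2 := by gcongr
  have r3 : r ^ 3 ≤ γ ^ 3 := by gcongr
  have a : r ^ 2 * m₃ ≤ γ ^ 2 * m₃ := by gcongr
  have b : K * r ^ 3 * s ≤ K * γ ^ 3 * s := by gcongr
  have c : r ^ 2 * m₃ / 6 + K * r ^ 3 * s < α * m₂ / 2 := by linarith
  have d : 0 < r * s ^ 3 * (α * m₂ / 2 - (r ^ 2 * m₃ / 6 + K * r ^ 3 * s)) :=
    mul_pos (by positivity) (sub_pos.2 c)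
  -- Since `θ * m₁ = (r + α * s) * m₂ / 2`, the `r` part cancels the second moment and the `α * s`
  -- part moves up to order `s ^ 3`.
  have e : s * (1 + θ * s) * m₁ * r - (r * s * m₁ + (r * s) ^ 2 * m₂ / 2 + (r * s) ^ 3 * m₃ / 6
        + K * (r * s) ^ 4) = r * s ^ 3 * (α * m₂ / 2 - (r ^ 2 * m₃ / 6 + K * r ^ 3 * s)) := by
    have : γ = r + α * s := by rw [hr]; ring
    have hh : θ * m₁ = (r + α * s) * m₂ / 2 := by rw [← this]; linarith
    linear_combination s ^ 2 * r * hh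
  linarith

/-! ### The scaled model -/

theorem mainTheorem4
    -- the law of the claim size `Y`: positive, with finite moment generating function near `0`
    (μ : Measure ℝ) [IsProbabilityMeasure μ]
    (hpos : ∀ᵐ y ∂μ, 0 < y)
    (hmgf : ∃ u₀ : ℝ, 0 < u₀ ∧
      ∀ s ∈ Set.Ioo (-u₀) u₀, Integrable (fun y : ℝ => Real.exp (y * s)) μ)
    (lam c θ : ℝ) (hlam : 0 < lam) (hθ : 0 < θ)
    (hc : c = (1 + θ) * lam * ∫ y, y ∂μ)
    (α : ℝ)
    (hα : diffusionExponent θ μ ^ 2 / 3 * ((∫ y, y ^ 3 ∂μ) / ∫ y, y ^ 2 ∂μ) < α) :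
    ∃ N : ℝ, 0 < N ∧ ∀ n : ℝ, N < n →
      ∀ {Ω : Type*} [MeasurableSpace Ω] (P : Measure Ω) [IsProbabilityMeasure P]
        (W Y : ℕ → Ω → ℝ),
        IsRiskModel (scaledIntensity lam n) (scaledClaimLaw μ n) P W Y →
        ∀ x : ℝ, 0 ≤ x →
          ruinProb P (scaledPremium c lam μ n) W Y x
            < Real.exp (-(diffusionExponent θ μ - α / √n) * x) := by
  obtain ⟨u, hu, hmgf⟩ := hmgf
  obtain ⟨K, hK, hexp⟩ := integral_exp_mul_le_cubic hpos hu hmgf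
  have mom : ∀ n : ℕ, Integrable (fun y : ℝ => y ^ n) μ := fun n => by
    simpa using integrable_pow_mul_exp_of_mem_interior_integrableExpSet
      (interior_integrableExpSet_of_Ioo hmgf ⟨by linarith, hu⟩ : (0 : ℝ) ∈ _) n
  have mpos : ∀ n : ℕ, 0 < ∫ y, y ^ n ∂μ := fun n => by
    have h0 : ∀ᵐ y ∂μ, 0 ≤ y ^ n := hpos.mono fun y hy => (pow_pos hy n).le
    refine (integral_nonneg_of_ae h0).lt_of_ne fun h => ?_
    have := (integral_eq_zero_iff_of_nonneg_ae h0 (mom n)).1 h.symm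
    obtain ⟨y, hy, hy'⟩ := (hpos.and this).exists
    exact (pow_pos hy n).ne' hy'
  have hm₁ : 0 < ∫ y, y ∂μ := by simpa using mpos 1
  have hm₂ := mpos 2
  have hm₃ := mpos 3
  set m₁ := ∫ y, y ∂μ
  set m₂ := ∫ y, y ^ 2 ∂μ
  set m₃ := ∫ y, y ^ 3 ∂μ
  set γ := diffusionExponent θ μ with hγdef
  have hγ : 0 < γ := by rw [hγdef, diffusionExponent]; positivity
  have hγm : γ * m₂ = 2 * θ * m₁ := by
    rw [hγdef, diffusionExponent, div_mul_cancel₀ _ hm₂.ne']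
  have hα0 : 0 ≤ α := le_trans (by positivity) hα.le
  obtain ⟨δ, hδ, H⟩ := exists_forall_lt_cubic hm₂ hγ hγm hK (half_pos hu) hα hα0 hm₃.le
  -- Chosen so that `n > N` means `1 / √n < δ`.
  refine ⟨(1 / δ) ^ 2, by positivity, ?_⟩
  intro n hn Ω _ P _ W Y hmodel x hx
  have hn0 : 0 < n := lt_trans (by positivity) hn
  have hq : 0 < √n := Real.sqrt_pos.2 hn0
  have hs : 1 / √n < δ := by
    rw [div_lt_comm₀ hq hδ]
    exact Real.lt_sqrt_of_sq_lt hn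
  obtain ⟨hr, hru, hlt⟩ := H (1 / √n) (by positivity) hs
  have hα' : α * (1 / √n) = α / √n := by ring
  rw [hα'] at hr hru hlt
  set r := γ - α / √n
  have hrn : 0 ≤ r * (1 / √n) := by positivity
  have hcn : scaledPremium c lam μ n = lam * m₁ * (√n + θ) := by
    rw [scaledPremium, hc]; ring
  set t := r * (1 / √n) with ht
  have e : ∀ y : ℝ, r * (y / √n) = t * y := fun y => by rw [ht]; ring
  have emb : AEMeasurable (fun y : ℝ => y / √n) μ := by fun_prop
  refine ruinProb_lt_exp hmodel (mul_pos hn0 hlam) (by rw [hcn]; positivity) hr.le ?_ ?_ hx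
  · rw [scaledClaimLaw, integrable_map_measure (by fun_prop) emb]
    simp only [Function.comp_def, e]
    simpa only [mul_comm] using hmgf t ⟨by linarith, by linarith⟩
  · rw [scaledClaimLaw, integral_map emb (by fun_prop), hcn, scaledIntensity]
    simp only [e]
    have b := hexp _ hrn hru
    have key : ∫ y, Real.exp (t * y) ∂μ - 1
        < 1 / √n * (1 + θ * (1 / √n)) * m₁ * r := by linarith
    have := mul_lt_mul_of_pos_left key (mul_pos hn0 hlam)
    refine this.trans_eq ?_
    have hsq : n = √n ^ 2 := (Real.sq_sqrt hn0.le).symm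
    field_simp
    nth_rewrite 1 [hsq]
    ring
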